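/- Let \(\mathcal N\subset\mathbb R^\nu\) be a smooth compact connected embedded submanifold (without boundary), with the Riemannian metric induced by \(\mathbb R^\nu\), and let \(F\in\mathcal C(\mathbb R^\nu,[0,+\infty))\) satisfy \(F^{-1}(\{0\})=\mathcal N\). For \(\gamma\in\mathcal C^1(\mathbb S^1,\mathcal N)\), let \[ \lambda(\gamma)=\inf\Bigl\{\int_{\mathbb S^1}|\tilde\gamma'| \;:\; \tilde\gamma\in\mathcal C^1(\mathbb S^1,\mathcal N)\text{ and }\gamma\text{ are homotopic in }\mathrm{VMO}(\mathbb S^1,\mathcal N)\Bigr\}, \] and call \(\gamma\) a minimising closed geodesic if \(|\gamma'|\) is constant and \(\int_{\mathbb S^1}|\gamma'|=\lambda(\gamma)\). For \(R\in(0,+\infty)\), let \(B_R\subset\mathbb R^2\) be the disk of radius \(R\) centred at \(0\) and let \[ \mathcal Q^R_{F,\gamma}=\inf\Bigl\{\int_{B_R}\frac{|Du|^2}{2}+F(u)\;:\;u\in W^{1,2}(B_R,\mathbb R^\nu),\ \operatorname{tr}_{\mathbb S^1}u(R\,\cdot)=\gamma\Bigr\}, \] where \(|Du|^2=|\partial_1u|^2+|\partial_2u|^2\).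 If \(\gamma\in\mathcal C^1(\mathbb S^1,\mathcal N)\) is a minimising closed geodesic, then \(\mathcal Q^R_{F,\gamma}<+\infty\) for every \(R\in(0,+\infty)\), and the function \[ R\in(0,+\infty)\longmapsto \mathcal Q^R_{F,\gamma}-\frac{\lambda(\gamma)^2}{4\pi}\log R \] is non-increasing. -/

import Mathlib

open MeasureTheory Set Filter Topology
open scoped ENNReal ContDiff Manifold

/-! The plane `ℝ²` is `ℂ` (with its real structure, Euclidean norm and Lebesgue measure), the unit
circle `𝕊¹` is `Circle`, and the ambient space `ℝ^ν` is `EuclideanSpace ℝ (Fin ν)`. -/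

noncomputable section

namespace GinzburgLandau

/-- The ambient Euclidean space `ℝ^ν`. -/
abbrev Space (ν : ℕ) : Type := EuclideanSpace ℝ (Fin ν)

variable {ν : ℕ}

/-! ### The target manifold -/

/-- `N` is a smooth (boundaryless, embedded) submanifold of `ℝ^ν`: for some dimension `d`, the
subset `N`, with its subspace topology, carries a smooth `d`-dimensional manifold structure for
which the inclusion is a smooth embedding. Its Riemannian metric is the one induced by `ℝ^ν`. -/
def IsSmoothSubmanifold (N : Set (Space ν)) : Prop :=
  ∃ (d : ℕ) (_ : ChartedSpace (EuclideanSpace ℝ (Fin d)) N),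
    IsManifold (𝓡 d) ∞ N ∧
      Manifold.IsSmoothEmbedding (𝓡 d) 𝓘(ℝ, Space ν) ∞ (Subtype.val : N → Space ν)

/-! ### Arc-length measure and VMO on the circle -/

/-- The Borel `σ`-algebra of the unit circle. -/
instance circleMeasurableSpace : MeasurableSpace Circle := borel Circle

/-- The measurable sets of the circle are the Borel sets. -/
instance circleBorelSpace : BorelSpace Circle := ⟨rfl⟩

/-- The arc-length measure on the unit circle (of total mass `2π`): the image of Lebesgue measure
under `θ ↦ exp (iθ)`, `-π < θ ≤ π`. -/
def arcLength : Measure Circle :=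
  (volume.restrict (Ioc (-Real.pi) Real.pi)).map Circle.exp

/-- The mean oscillation of `f` on the arc `{z ∈ 𝕊¹ : |z - ζ| < r}`, that is, the average on this
arc of the distance of `f` to its mean value on this arc. -/
def meanOscillation (f : Circle → Space ν) (ζ : Circle) (r : ℝ) : ℝ≥0∞ :=
  ⨍⁻ z in Metric.ball ζ r, ‖f z - ⨍ w in Metric.ball ζ r, f w ∂arcLength‖ₑ ∂arcLength

/-- `f ∈ VMO(𝕊¹, N)`: `f` is integrable, takes its values in `N` almost everywhere, and its mean
oscillations on arcs tend to `0` uniformly as the size of the arc tends to `0`. -/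
def MemVMO (N : Set (Space ν)) (f : Circle → Space ν) : Prop :=
  Integrable f arcLength ∧ (∀ᵐ ζ ∂arcLength, f ζ ∈ N) ∧
    ∀ ε : ℝ≥0∞, 0 < ε → ∃ δ : ℝ, 0 < δ ∧
      ∀ r : ℝ, 0 < r → r < δ → ∀ ζ : Circle, meanOscillation f ζ r ≤ ε

/-- The norm of `BMO(𝕊¹, ℝ^ν)`: the `L¹` norm plus the supremum of all mean oscillations. -/
def bmoNorm (f : Circle → Space ν) : ℝ≥0∞ :=
  (∫⁻ ζ, ‖f ζ‖ₑ ∂arcLength) +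
    ⨆ (ζ : Circle) (r : ℝ) (_ : 0 < r), meanOscillation f ζ r

/-- `f` and `g` are homotopic in `VMO(𝕊¹, N)`: they are joined by a path in `VMO(𝕊¹, N)` which is
continuous for the `BMO` norm. -/
def HomotopicVMO (N : Set (Space ν)) (f g : Circle → Space ν) : Prop :=
  ∃ H : ℝ → Circle → Space ν,
    (∀ t ∈ Icc (0 : ℝ) 1, MemVMO N (H t)) ∧
    (∀ t ∈ Icc (0 : ℝ) 1,
      Tendsto (fun s : ℝ => bmoNorm (fun ζ => H s ζ - H t ζ)) (𝓝[Icc 0 1] t) (𝓝 0)) ∧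
    H 0 =ᵐ[arcLength] f ∧ H 1 =ᵐ[arcLength] g

/-! ### Closed curves, minimal length, minimising closed geodesics -/

/-- `γ ∈ C¹(𝕊¹, N)`. -/
def IsC1Loop (N : Set (Space ν)) (γ : Circle → Space ν) : Prop :=
  ContDiff ℝ 1 (fun θ : ℝ => γ (Circle.exp θ)) ∧ ∀ ζ : Circle, γ ζ ∈ N

/-- The speed `|γ'|` of a closed curve at the point `exp (iθ)` of the circle. -/
def speed (γ : Circle → Space ν) (θ : ℝ) : ℝ :=
  ‖deriv (fun t : ℝ => γ (Circle.exp t)) θ‖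

/-- The length `∫_{𝕊¹} |γ'|` of a closed curve. -/
def curveLength (γ : Circle → Space ν) : ℝ :=
  ∫ θ in (-Real.pi)..Real.pi, speed γ θ

/-- The minimal length `λ(γ)` in the homotopy class of `γ`: the infimum of the lengths of the
closed curves in `C¹(𝕊¹, N)` that are homotopic to `γ` in `VMO(𝕊¹, N)`. -/
def minimalLength (N : Set (Space ν)) (γ : Circle → Space ν) : ℝ :=
  sInf {ℓ : ℝ | ∃ β : Circle → Space ν,
    IsC1Loop N β ∧ HomotopicVMO N β γ ∧ ℓ = curveLength β}

/-- `γ ∈ C¹(𝕊¹, N)` is a minimising closed geodesic: it is parametrised with constant speed and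
its length is minimal in its homotopy class. (Constant curves are allowed.) -/
def IsMinimisingClosedGeodesic (N : Set (Space ν)) (γ : Circle → Space ν) : Prop :=
  IsC1Loop N γ ∧ (∃ c : ℝ, ∀ θ : ℝ, speed γ θ = c) ∧ curveLength γ = minimalLength N γ

/-! ### Sobolev maps on disks and their traces -/

/-- `Du` is a weak derivative of `u` on the open set `U ⊆ ℝ²`:
`∫_U (∂_v φ) u = - ∫_U φ Du[v]` for all `φ ∈ C_c^∞(U)` and all directions `v`. -/
def IsWeakDeriv (U : Set ℂ) (u : ℂ → Space ν) (Du : ℂ → ℂ →L[ℝ] Space ν) : Prop :=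
  ∀ φ : ℂ → ℝ, ContDiff ℝ ∞ φ → HasCompactSupport φ → tsupport φ ⊆ U → ∀ v : ℂ,
    ∫ x in U, fderiv ℝ φ x v • u x = - ∫ x in U, φ x • Du x v

/-- `u ∈ W^{1,2}(U, ℝ^ν)` with weak derivative `Du`. -/
def IsSobolevMap (U : Set ℂ) (u : ℂ → Space ν) (Du : ℂ → ℂ →L[ℝ] Space ν) : Prop :=
  MemLp u 2 (volume.restrict U) ∧ MemLp Du 2 (volume.restrict U) ∧ IsWeakDeriv U u Du

/-- For `u ∈ W^{1,2}(B_R, ℝ^ν)` with weak derivative `Du`, the identity `tr_{𝕊¹} u(R ·) = γ`. The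
trace of `u` on `∂B_R` is the square-integrable function that makes Green's formula
`∫_{B_R} (∂_v φ) u + φ Du[v] = ∫_{∂B_R} φ (n · v) (tr u)` true for all test functions `φ` on the
plane and all directions `v`, where `n` is the outward unit normal. -/
def HasTrace (R : ℝ) (u : ℂ → Space ν) (Du : ℂ → ℂ →L[ℝ] Space ν) (γ : Circle → Space ν) : Prop :=
  MemLp γ 2 arcLength ∧
  ∀ φ : ℂ → ℝ, ContDiff ℝ ∞ φ → HasCompactSupport φ → ∀ v : ℂ,
    ∫ x in Metric.ball (0 : ℂ) R, (fderiv ℝ φ x v • u x + φ x • Du x v) =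
      R • ∫ ζ : Circle, (φ (R * (ζ : ℂ)) * inner ℝ (ζ : ℂ) v) • γ ζ ∂arcLength

/-- The energy `∫_{B_R} |Du|²/2 + F(u)`, in `[0, ∞]`, where `|Du|² = |∂₁u|² + |∂₂u|²`. -/
def energy (F : Space ν → ℝ) (R : ℝ) (u : ℂ → Space ν) (Du : ℂ → ℂ →L[ℝ] Space ν) : ℝ≥0∞ :=
  ∫⁻ x in Metric.ball (0 : ℂ) R,
    ENNReal.ofReal ((‖Du x 1‖ ^ 2 + ‖Du x Complex.I‖ ^ 2) / 2 + F (u x))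

/-- The minimal energy `Q^R_{F,γ} ∈ [0, ∞]`: the infimum of `∫_{B_R} |Du|²/2 + F(u)` over all
`u ∈ W^{1,2}(B_R, ℝ^ν)` such that `tr_{𝕊¹} u(R ·) = γ`. -/
def minimalEnergy (F : Space ν → ℝ) (γ : Circle → Space ν) (R : ℝ) : ℝ≥0∞ :=
  sInf {e : ℝ≥0∞ | ∃ (u : ℂ → Space ν) (Du : ℂ → ℂ →L[ℝ] Space ν),
    IsSobolevMap (Metric.ball 0 R) u Du ∧ HasTrace R u Du γ ∧ e = energy F R u Du}

end GinzburgLandau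

end

/-! The homogeneous extension of the geodesic is the only competitor that is needed.

Let `u` be admissible on `B_R`. For `R ≤ S`, extend it to `B_S` by `x ↦ γ(x / |x|)` on the annulus
`R ≤ |x| < S`. The extension takes its values in `N` there, so that the potential vanishes, and if
`|γ'| = c` then the energy density is `c² / (2|x|²)`, whose integral over the annulus is
`π c² log (S / R)`. As `λ(γ)` is the length `2πc` of `γ`, we have `π c² = λ(γ)² / (4π)`, so that
`Q^S ≤ Q^R + λ(γ)² / (4π) log (S / R)` (`minimalEnergy_le_add`), which is the monotonicity.
Finiteness of `Q^R` is witnessed by the `1`-homogeneous extension `x ↦ (|x| / R) γ(x / |x|)`, which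
has bounded energy density (`minimalEnergy_ne_top`).

Admissibility of both competitors comes from a single Green formula (`green_annulus`) for maps
`r e^{iθ} ↦ h(r) γ(e^{iθ})` on annuli: in polar coordinates the Jacobian times `∂_v (φ u)` is the
divergence of a `C¹` field in `(r, θ)`, the angular boundary terms cancel by periodicity and the
radial ones are the integrals over the two bounding circles. When maps are glued across a circle,
the boundary integrals on it cancel (`HasTrace.glue`). Green's formula with boundary term in turn
contains the definition of a weak derivative (`HasTrace.isSobolevMap`). -/

noncomputable section

namespace GinzburgLandau

variable {E : Type*} [NormedAddCommGroup E] [NormedSpace ℝ E] {ν : ℕ}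

/-! ### Polar coordinates on annuli -/

theorem polarCoord_symm_eq_mul_exp (p : ℝ × ℝ) :
    Complex.polarCoord.symm p = p.1 * (Circle.exp p.2 : ℂ) := by
  rw [Complex.polarCoord_symm_apply, Circle.coe_exp, Complex.exp_mul_I, Complex.ofReal_cos,
    Complex.ofReal_sin]

theorem norm_ofReal_mul_circleExp {r : ℝ} (hr : 0 ≤ r) (θ : ℝ) :
    ‖(r * (Circle.exp θ : ℂ))‖ = r := by
  simp [abs_of_nonneg hr]

theorem arg_ofReal_mul_circleExp {r θ : ℝ} (hr : 0 < r) (hθ : θ ∈ Ioc (-Real.pi) Real.pi) :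
    (r * (Circle.exp θ : ℂ)).arg = θ := by
  rw [Complex.arg_real_mul _ hr, Circle.arg_exp hθ.1 hθ.2]

theorem polarRectangle_ae_eq {a b : ℝ} (ha : 0 ≤ a) :
    (polarCoord.target ∩ {p | p.1 ∈ Ico a b} : Set (ℝ × ℝ)) =ᵐ[volume]
      Icc a b ×ˢ Icc (-Real.pi) Real.pi := by
  have h : (polarCoord.target ∩ {p | p.1 ∈ Ico a b} : Set (ℝ × ℝ)) =
      (Ioi 0 ∩ Ico a b) ×ˢ Ioo (-Real.pi) Real.pi := by
    ext p
    simp only [polarCoord_target, mem_inter_iff, mem_prod, mem_ofPred_eq]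
    tauto
  rw [h]
  refine Measure.set_prod_ae_eq ?_ Ioo_ae_eq_Icc
  refine EventuallyEq.trans ?_ (Ioo_ae_eq_Icc (μ := volume) (a := a) (b := b))
  have hsub : (Ioi 0 ∩ Ico a b : Set ℝ) =ᵐ[volume] (Ioi 0 ∩ Ioo a b : Set ℝ) :=
    (EventuallyEq.refl _ _).inter (Ioo_ae_eq_Ico (μ := volume) (a := a) (b := b)).symm
  have hIoo : (Ioi 0 ∩ Ioo a b : Set ℝ) = Ioo a b :=
    inter_eq_right.2 fun x hx => ha.trans_lt hx.1
  exact hsub.trans (EventuallyEq.of_eq hIoo)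

theorem indicator_annulus_polar {α : Type*} [Zero α] {a b : ℝ} (K : ℂ → α)
    {p : ℝ × ℝ} (hp : p ∈ polarCoord.target) :
    (Metric.ball (0 : ℂ) b \ Metric.ball 0 a).indicator K (Complex.polarCoord.symm p) =
      {q : ℝ × ℝ | q.1 ∈ Ico a b}.indicator (fun q => K (q.1 * (Circle.exp q.2 : ℂ))) p := by
  have hn := norm_ofReal_mul_circleExp (le_of_lt hp.1) p.2
  rw [polarCoord_symm_eq_mul_exp]
  simp only [indicator, Set.mem_sdiff, mem_ball_zero_iff, hn, not_lt, mem_ofPred_eq, mem_Ico,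
    and_comm]

/-- Integration in polar coordinates over the annulus `a ≤ |x| < b`. -/
theorem setIntegral_annulus {a b : ℝ} (ha : 0 ≤ a) (K : ℂ → E) :
    ∫ x in Metric.ball (0 : ℂ) b \ Metric.ball 0 a, K x =
      ∫ p in Icc a b ×ˢ Icc (-Real.pi) Real.pi, p.1 • K (p.1 * (Circle.exp p.2 : ℂ)) := by
  have hS : MeasurableSet {q : ℝ × ℝ | q.1 ∈ Ico a b} := measurable_fst measurableSet_Ico
  rw [← integral_indicator (measurableSet_ball.diff measurableSet_ball),
    ← Complex.integral_comp_polarCoord_symm, ← setIntegral_congr_set (polarRectangle_ae_eq ha),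
    ← setIntegral_indicator hS]
  refine setIntegral_congr_fun polarCoord.open_target.measurableSet fun p hp => ?_
  rw [indicator_annulus_polar K hp, indicator_apply, indicator_apply]
  split_ifs <;> simp

/-- Integration in polar coordinates over the annulus `a ≤ |x| < b`, for nonnegative functions. -/
theorem setLIntegral_annulus {a b : ℝ} (ha : 0 ≤ a) (K : ℂ → ℝ≥0∞) :
    ∫⁻ x in Metric.ball (0 : ℂ) b \ Metric.ball 0 a, K x =
      ∫⁻ p in Icc a b ×ˢ Icc (-Real.pi) Real.pi,
        ENNReal.ofReal p.1 * K (p.1 * (Circle.exp p.2 : ℂ)) := by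
  have hS : MeasurableSet {q : ℝ × ℝ | q.1 ∈ Ico a b} := measurable_fst measurableSet_Ico
  rw [← lintegral_indicator (measurableSet_ball.diff measurableSet_ball),
    ← Complex.lintegral_comp_polarCoord_symm, ← setLIntegral_congr (polarRectangle_ae_eq ha),
    inter_comm, ← setLIntegral_indicator hS]
  refine setLIntegral_congr_fun polarCoord.open_target.measurableSet fun p hp => ?_
  rw [indicator_annulus_polar K hp, smul_eq_mul, indicator_apply, indicator_apply]
  split_ifs <;> simp

/-! ### Maps with separated polar variables -/

/-- The map `r e^{iθ} ↦ h(r) γ(e^{iθ})` of the plane. -/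
def radialMap (h : ℝ → ℝ) (γ : Circle → E) (x : ℂ) : E :=
  h ‖x‖ • γ (Circle.exp x.arg)

/-- The derivative of `radialMap h γ` at `x = r e^{iθ}`, namely
`v ↦ ⟨e^{iθ}, v⟩ h'(r) γ(e^{iθ}) + ⟨i e^{iθ}, v⟩ (h(r) / r) γ'(e^{iθ})`. Its value at `0` carries no
information. -/
def radialDeriv (h : ℝ → ℝ) (γ : Circle → E) (x : ℂ) : ℂ →L[ℝ] E :=
  (innerSL ℝ (Circle.exp x.arg : ℂ)).smulRight (deriv h ‖x‖ • γ (Circle.exp x.arg)) +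
    (innerSL ℝ (Complex.I * (Circle.exp x.arg : ℂ))).smulRight
      ((h ‖x‖ / ‖x‖) • deriv (fun t : ℝ => γ (Circle.exp t)) x.arg)

theorem radialDeriv_apply (h : ℝ → ℝ) (γ : Circle → E) (x v : ℂ) :
    radialDeriv h γ x v =
      (inner ℝ (Circle.exp x.arg : ℂ) v * deriv h ‖x‖) • γ (Circle.exp x.arg) +
        (inner ℝ (Complex.I * (Circle.exp x.arg : ℂ)) v * (h ‖x‖ / ‖x‖)) •
          deriv (fun t : ℝ => γ (Circle.exp t)) x.arg := by
  simp [radialDeriv, smul_smul]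

theorem hasDerivAt_coe_circleExp (θ : ℝ) :
    HasDerivAt (fun t : ℝ => (Circle.exp t : ℂ)) (Complex.I * (Circle.exp θ : ℂ)) θ := by
  have h := ((Complex.ofRealCLM.hasDerivAt (x := θ)).mul_const Complex.I).cexp
  simpa [Circle.coe_exp, mul_comm] using h

theorem contDiff_coe_circleExp : ContDiff ℝ ∞ (fun t : ℝ => (Circle.exp t : ℂ)) := by
  simp only [Circle.coe_exp]
  exact (Complex.ofRealCLM.contDiff.mul contDiff_const).cexp

/-- Expansion of a vector in the orthonormal frame `(e_r, e_θ) = (ζ, iζ)`. -/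
theorem inner_smul_add_inner_smul_circle (ζ : Circle) (v : ℂ) :
    inner ℝ (ζ : ℂ) v • (ζ : ℂ) + inner ℝ (Complex.I * (ζ : ℂ)) v • (Complex.I * (ζ : ℂ)) = v := by
  have h : (ζ : ℂ).re * (ζ : ℂ).re + (ζ : ℂ).im * (ζ : ℂ).im = 1 := by
    rw [← Complex.normSq_apply, Circle.normSq_coe]
  apply Complex.ext
  · simp [Complex.inner]; linear_combination v.re * h
  · simp [Complex.inner]; linear_combination v.im * h

/-! ### Green's formula on annuli -/

theorem fderiv_apply_one_zero {f : ℝ × ℝ → E} (hf : Differentiable ℝ f) (p : ℝ × ℝ) :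
    fderiv ℝ f p (1, 0) = deriv (fun r : ℝ => f (r, p.2)) p.1 :=
  ((hf p).hasFDerivAt.comp_hasDerivAt p.1
    ((hasDerivAt_id p.1).prodMk (hasDerivAt_const p.1 p.2))).deriv.symm

theorem fderiv_apply_zero_one {f : ℝ × ℝ → E} (hf : Differentiable ℝ f) (p : ℝ × ℝ) :
    fderiv ℝ f p (0, 1) = deriv (fun θ : ℝ => f (p.1, θ)) p.2 :=
  ((hf p).hasFDerivAt.comp_hasDerivAt p.2
    ((hasDerivAt_const p.2 p.1).prodMk (hasDerivAt_id p.2))).deriv.symm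

/-- The divergence, in polar coordinates, of the field whose flux Green's formula computes: the
Jacobian `r` times `∂_v(φ u)` is `∂_r (r ⟨e_r, v⟩ φ u) + ∂_θ (⟨e_θ, v⟩ φ u)`. -/
theorem polar_divergence {h : ℝ → ℝ} {γ : Circle → E} {φ : ℂ → ℝ} (hh : ContDiff ℝ 1 h)
    (hγ : ContDiff ℝ 1 (fun θ : ℝ => γ (Circle.exp θ))) (hφ : ContDiff ℝ 1 φ) (v : ℂ)
    {p : ℝ × ℝ} (hp : 0 < p.1) (hp' : p.2 ∈ Ioc (-Real.pi) Real.pi) :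
    deriv (fun r : ℝ => (r * inner ℝ (Circle.exp p.2 : ℂ) v * φ (r * (Circle.exp p.2 : ℂ)) * h r) •
        γ (Circle.exp p.2)) p.1 +
      deriv (fun θ : ℝ => (inner ℝ (Complex.I * (Circle.exp θ : ℂ)) v *
        φ (p.1 * (Circle.exp θ : ℂ)) * h p.1) • γ (Circle.exp θ)) p.2 =
      p.1 • (fderiv ℝ φ (p.1 * (Circle.exp p.2 : ℂ)) v •
          radialMap h γ (p.1 * (Circle.exp p.2 : ℂ)) +
        φ (p.1 * (Circle.exp p.2 : ℂ)) • radialDeriv h γ (p.1 * (Circle.exp p.2 : ℂ)) v) := by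
  obtain ⟨r, θ⟩ := p
  dsimp only at *
  have hφd : HasFDerivAt φ (fderiv ℝ φ (r * (Circle.exp θ : ℂ))) (r * (Circle.exp θ : ℂ)) :=
    (hφ.differentiable one_ne_zero _).hasFDerivAt
  have hφr : HasDerivAt (fun s : ℝ => φ (s * (Circle.exp θ : ℂ)))
      (fderiv ℝ φ (r * (Circle.exp θ : ℂ)) (Circle.exp θ : ℂ)) r := by
    have h1 : HasDerivAt (fun s : ℝ => (s * (Circle.exp θ : ℂ))) (1 * (Circle.exp θ : ℂ)) r :=
      (Complex.ofRealCLM.hasDerivAt (x := r)).mul_const _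
    rw [one_mul] at h1
    exact hφd.comp_hasDerivAt r h1
  have hφθ : HasDerivAt (fun t : ℝ => φ (r * (Circle.exp t : ℂ)))
      (r * fderiv ℝ φ (r * (Circle.exp θ : ℂ)) (Complex.I * (Circle.exp θ : ℂ))) θ := by
    have h1 : HasDerivAt (fun t : ℝ => (r * (Circle.exp t : ℂ)))
        (r • (Complex.I * (Circle.exp θ : ℂ))) θ := by
      simpa using (hasDerivAt_coe_circleExp θ).const_mul (r : ℂ)
    have h2 := hφd.comp_hasDerivAt θ h1
    rw [map_smul, smul_eq_mul] at h2
    exact h2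
  have hh' : HasDerivAt h (deriv h r) r := (hh.differentiable one_ne_zero r).hasDerivAt
  have hγ' : HasDerivAt (fun t : ℝ => γ (Circle.exp t))
      (deriv (fun t : ℝ => γ (Circle.exp t)) θ) θ :=
    (hγ.differentiable one_ne_zero θ).hasDerivAt
  have hn : HasDerivAt (fun t : ℝ => inner ℝ (Complex.I * (Circle.exp t : ℂ)) v)
      (-inner ℝ (Circle.exp θ : ℂ) v) θ := by
    have h1 := ((hasDerivAt_coe_circleExp θ).const_mul Complex.I).inner ℝ (hasDerivAt_const θ v)
    have h2 : Complex.I * (Complex.I * (Circle.exp θ : ℂ)) = -(Circle.exp θ : ℂ) := by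
      rw [← mul_assoc, Complex.I_mul_I, neg_one_mul]
    rw [h2, inner_zero_right, zero_add, inner_neg_left] at h1
    exact h1
  have hv : fderiv ℝ φ (r * (Circle.exp θ : ℂ)) v =
      inner ℝ (Circle.exp θ : ℂ) v * fderiv ℝ φ (r * (Circle.exp θ : ℂ)) (Circle.exp θ : ℂ) +
      inner ℝ (Complex.I * (Circle.exp θ : ℂ)) v *
        fderiv ℝ φ (r * (Circle.exp θ : ℂ)) (Complex.I * (Circle.exp θ : ℂ)) := by
    conv_lhs => rw [← inner_smul_add_inner_smul_circle (Circle.exp θ) v]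
    rw [map_add, map_smul, map_smul, smul_eq_mul, smul_eq_mul]
  have hr := ((((hasDerivAt_id' r).mul_const (inner ℝ (Circle.exp θ : ℂ) v)).fun_mul
    hφr).fun_mul hh').smul_const (γ (Circle.exp θ))
  have hθ := ((hn.fun_mul hφθ).mul_const (h r)).fun_smul hγ'
  rw [hr.deriv, hθ.deriv, radialDeriv_apply, radialMap,
    norm_ofReal_mul_circleExp hp.le, arg_ofReal_mul_circleExp hp hp', hv]
  match_scalars
  · field_simp; ring
  · field_simp

theorem integral_arcLength {f : Circle → E} (hf : AEStronglyMeasurable f arcLength) :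
    ∫ ζ, f ζ ∂arcLength = ∫ θ in (-Real.pi)..Real.pi, f (Circle.exp θ) := by
  rw [intervalIntegral.integral_of_le (by linarith [Real.pi_pos])]
  exact integral_map Circle.exp.continuous.measurable.aemeasurable hf

theorem stronglyMeasurable_of_continuous_comp_exp {X : Type*} [TopologicalSpace X]
    [TopologicalSpace.PseudoMetrizableSpace X] {γ : Circle → X}
    (hγ : Continuous (fun θ : ℝ => γ (Circle.exp θ))) : StronglyMeasurable γ := by
  have hc : Continuous (fun ζ : Circle => (ζ : ℂ)) := continuous_induced_dom
  have h : Measurable (fun ζ : Circle => (ζ : ℂ).arg) :=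
    Complex.measurable_arg.comp hc.measurable
  have := hγ.stronglyMeasurable.comp_measurable h
  simpa [Function.comp_def, Circle.exp_arg] using this

/-- Green's formula on the annulus `a ≤ |x| < b` for the map `r e^{iθ} ↦ h(r) γ(e^{iθ})`. For
`a = 0` the annulus is the disk and the inner boundary term vanishes. -/
theorem green_annulus {h : ℝ → ℝ} {γ : Circle → E} {φ : ℂ → ℝ} {a b : ℝ} (ha : 0 ≤ a) (hab : a ≤ b)
    (hh : ContDiff ℝ 1 h) (hγ : ContDiff ℝ 1 (fun θ : ℝ => γ (Circle.exp θ)))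
    (hφ : ContDiff ℝ 1 φ) (v : ℂ) :
    ∫ x in Metric.ball (0 : ℂ) b \ Metric.ball 0 a,
        (fderiv ℝ φ x v • radialMap h γ x + φ x • radialDeriv h γ x v) =
      (b * h b) • ∫ ζ : Circle, (φ (b * (ζ : ℂ)) * inner ℝ (ζ : ℂ) v) • γ ζ ∂arcLength -
      (a * h a) • ∫ ζ : Circle, (φ (a * (ζ : ℂ)) * inner ℝ (ζ : ℂ) v) • γ ζ ∂arcLength := by
  set f : ℝ × ℝ → E := fun p => (p.1 * inner ℝ (Circle.exp p.2 : ℂ) v *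
    φ (p.1 * (Circle.exp p.2 : ℂ)) * h p.1) • γ (Circle.exp p.2) with hf
  set g : ℝ × ℝ → E := fun p => (inner ℝ (Complex.I * (Circle.exp p.2 : ℂ)) v *
    φ (p.1 * (Circle.exp p.2 : ℂ)) * h p.1) • γ (Circle.exp p.2) with hg
  have hexp : ContDiff ℝ 1 (fun p : ℝ × ℝ => (Circle.exp p.2 : ℂ)) :=
    (contDiff_coe_circleExp.of_le (by norm_cast)).comp contDiff_snd
  have hφp : ContDiff ℝ 1 (fun p : ℝ × ℝ => φ (p.1 * (Circle.exp p.2 : ℂ))) :=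
    hφ.comp ((Complex.ofRealCLM.contDiff.comp contDiff_fst).mul hexp)
  have hfC : ContDiff ℝ 1 f :=
    (((contDiff_fst.mul (hexp.inner ℝ contDiff_const)).mul hφp).mul (hh.comp contDiff_fst)).smul
      (hγ.comp contDiff_snd)
  have hgC : ContDiff ℝ 1 g :=
    ((((contDiff_const.mul hexp).inner ℝ contDiff_const).mul hφp).mul (hh.comp contDiff_fst)).smul
      (hγ.comp contDiff_snd)
  have hfd := hfC.differentiable one_ne_zero
  have hgd := hgC.differentiable one_ne_zero
  have hdiv := integral_divergence_prod_Icc_of_hasFDerivAt_of_le f g (fderiv ℝ f) (fderiv ℝ g)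
    (a, -Real.pi) (b, Real.pi) ⟨hab, by simp [Real.pi_pos.le]⟩
    hfC.continuous.continuousOn hgC.continuous.continuousOn
    (fun x _ => (hfd x).hasFDerivAt) (fun x _ => (hgd x).hasFDerivAt)
    (Continuous.continuousOn (((hfC.continuous_fderiv one_ne_zero).clm_apply continuous_const).add
      ((hgC.continuous_fderiv one_ne_zero).clm_apply continuous_const))
      |>.integrableOn_compact isCompact_Icc)
  have hIoo : Ioo a b ×ˢ Ioo (-Real.pi) Real.pi =ᵐ[(volume : Measure (ℝ × ℝ))]
      Icc a b ×ˢ Icc (-Real.pi) Real.pi :=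
    Measure.set_prod_ae_eq Ioo_ae_eq_Icc Ioo_ae_eq_Icc
  have hperiod : Circle.exp (-Real.pi) = Circle.exp Real.pi := by
    rw [← Circle.exp_sub_two_pi Real.pi]; congr 1; ring
  have hmeas : ∀ s : ℝ, AEStronglyMeasurable
      (fun ζ : Circle => (φ (s * (ζ : ℂ)) * inner ℝ (ζ : ℂ) v) • γ ζ) arcLength := fun s => by
    have hc : Continuous (fun ζ : Circle => φ (s * (ζ : ℂ)) * inner ℝ (ζ : ℂ) v) :=
      (hφ.continuous.comp (continuous_const.mul continuous_induced_dom)).mul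
        (continuous_induced_dom.inner continuous_const)
    exact (hc.measurable.stronglyMeasurable.smul
      (stronglyMeasurable_of_continuous_comp_exp hγ.continuous)).aestronglyMeasurable
  have hbdry : ∀ s : ℝ, (s * h s) •
      ∫ ζ : Circle, (φ (s * (ζ : ℂ)) * inner ℝ (ζ : ℂ) v) • γ ζ ∂arcLength =
      ∫ θ in (-Real.pi)..Real.pi, f (s, θ) := fun s => by
    rw [integral_arcLength (hmeas s), ← intervalIntegral.integral_smul]
    refine intervalIntegral.integral_congr fun θ _ => ?_
    simp only [hf, smul_smul]
    congr 1; ring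
  rw [setIntegral_annulus ha, hbdry, hbdry, ← setIntegral_congr_set hIoo]
  rw [Icc_prod_eq, ← setIntegral_congr_set hIoo] at hdiv
  -- The two angular boundary terms, at `θ = ±π`, cancel.
  simp only [hg, hperiod, sub_self, zero_add] at hdiv
  rw [← hdiv]
  refine setIntegral_congr_fun (measurableSet_Ioo.prod measurableSet_Ioo) fun p hp => ?_
  rw [← polar_divergence hh hγ hφ v (ha.trans_lt hp.1.1) (Ioo_subset_Ioc_self hp.2),
    fderiv_apply_one_zero hfd, fderiv_apply_zero_one hgd]

/-! ### Measurability and bounds -/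

theorem stronglyMeasurable_radialMap {h : ℝ → ℝ} {γ : Circle → E} (hh : Continuous h)
    (hγ : Continuous (fun θ : ℝ => γ (Circle.exp θ))) : StronglyMeasurable (radialMap h γ) :=
  (hh.comp continuous_norm).stronglyMeasurable.smul
    (hγ.stronglyMeasurable.comp_measurable Complex.measurable_arg)

theorem stronglyMeasurable_smulRight {c : ℂ → StrongDual ℝ ℂ} {w : ℂ → E}
    (hc : StronglyMeasurable c) (hw : StronglyMeasurable w) :
    StronglyMeasurable (fun x => (c x).smulRight (w x)) := by
  have hL : Continuous (fun p : StrongDual ℝ ℂ × E => p.1.smulRight p.2) :=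
    (ContinuousLinearMap.smulRightL ℝ ℂ E).continuous₂
  exact hL.comp_stronglyMeasurable (hc.prodMk hw)

theorem stronglyMeasurable_radialDeriv {h : ℝ → ℝ} {γ : Circle → E} (hh : ContDiff ℝ 1 h)
    (hγ : ContDiff ℝ 1 (fun θ : ℝ => γ (Circle.exp θ))) :
    StronglyMeasurable (radialDeriv h γ) := by
  have he : Continuous (fun θ : ℝ => (Circle.exp θ : ℂ)) := contDiff_coe_circleExp.continuous
  have hrad : StronglyMeasurable (fun x : ℂ => innerSL ℝ (Circle.exp x.arg : ℂ)) :=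
    ((innerSL ℝ).continuous.comp he).stronglyMeasurable.comp_measurable Complex.measurable_arg
  have hang : StronglyMeasurable (fun x : ℂ => innerSL ℝ (Complex.I * (Circle.exp x.arg : ℂ))) :=
    ((innerSL ℝ).continuous.comp (continuous_const.mul he)).stronglyMeasurable.comp_measurable
      Complex.measurable_arg
  have hquot : StronglyMeasurable (fun x : ℂ => h ‖x‖ / ‖x‖) :=
    ((hh.continuous.measurable.comp measurable_norm).div measurable_norm).stronglyMeasurable
  exact (stronglyMeasurable_smulRight hrad
    (((hh.continuous_deriv le_rfl).comp continuous_norm).stronglyMeasurable.smul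
      (hγ.continuous.stronglyMeasurable.comp_measurable Complex.measurable_arg))).add
    (stronglyMeasurable_smulRight hang (hquot.smul
      ((hγ.continuous_deriv le_rfl).stronglyMeasurable.comp_measurable Complex.measurable_arg)))

theorem norm_mem_Icc_of_mem_annulus {a b : ℝ} {x : ℂ}
    (hx : x ∈ Metric.ball (0 : ℂ) b \ Metric.ball 0 a) : ‖x‖ ∈ Icc a b := by
  simp only [Set.mem_sdiff, mem_ball_zero_iff, not_lt] at hx
  exact ⟨hx.2, hx.1.le⟩

theorem exists_bound_comp_arg {G : Type*} [NormedAddCommGroup G] {g : ℝ → G} (hg : Continuous g) :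
    ∃ C, ∀ x : ℂ, ‖g x.arg‖ ≤ C := by
  obtain ⟨C, hC⟩ := isCompact_Icc.exists_bound_of_continuousOn
    (hg.continuousOn (s := Icc (-Real.pi) Real.pi))
  exact ⟨C, fun x => hC _ ⟨(Complex.neg_pi_lt_arg x).le, Complex.arg_le_pi x⟩⟩

theorem exists_bound_radialMap {h : ℝ → ℝ} {γ : Circle → E} (hh : Continuous h)
    (hγ : Continuous (fun θ : ℝ => γ (Circle.exp θ))) (a b : ℝ) :
    ∃ C, ∀ x ∈ Metric.ball (0 : ℂ) b \ Metric.ball 0 a, ‖radialMap h γ x‖ ≤ C := by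
  obtain ⟨A, hA⟩ := exists_bound_comp_arg hγ
  obtain ⟨B, hB⟩ := isCompact_Icc.exists_bound_of_continuousOn (hh.continuousOn (s := Icc a b))
  refine ⟨B * A, fun x hx => ?_⟩
  have hB' := hB _ (norm_mem_Icc_of_mem_annulus hx)
  rw [radialMap, norm_smul]
  exact mul_le_mul hB' (hA x) (norm_nonneg _) ((norm_nonneg _).trans hB')

/-- The hypothesis on `h(r) / r` matters only when the annulus reaches the origin, where the angular
derivative may blow up. -/
theorem exists_bound_radialDeriv {h : ℝ → ℝ} {γ : Circle → E} (hh : ContDiff ℝ 1 h)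
    (hγ : ContDiff ℝ 1 (fun θ : ℝ => γ (Circle.exp θ))) {a b : ℝ}
    (hq : ∃ D, ∀ r ∈ Icc a b, ‖h r / r‖ ≤ D) :
    ∃ C, ∀ x ∈ Metric.ball (0 : ℂ) b \ Metric.ball 0 a, ‖radialDeriv h γ x‖ ≤ C := by
  obtain ⟨A, hA⟩ := exists_bound_comp_arg hγ.continuous
  obtain ⟨A', hA'⟩ := exists_bound_comp_arg (hγ.continuous_deriv le_rfl)
  obtain ⟨B, hB⟩ := isCompact_Icc.exists_bound_of_continuousOn
    ((hh.continuous_deriv le_rfl).continuousOn (s := Icc a b))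
  obtain ⟨D, hD⟩ := hq
  refine ⟨B * A + D * A', fun x hx => ?_⟩
  have hB' := hB _ (norm_mem_Icc_of_mem_annulus hx)
  have hD' := hD _ (norm_mem_Icc_of_mem_annulus hx)
  refine (norm_add_le _ _).trans (add_le_add ?_ ?_)
  · rw [ContinuousLinearMap.norm_smulRight_apply, innerSL_apply_norm, Circle.norm_coe, one_mul,
      norm_smul]
    exact mul_le_mul hB' (hA x) (norm_nonneg _) ((norm_nonneg _).trans hB')
  · rw [ContinuousLinearMap.norm_smulRight_apply, innerSL_apply_norm, norm_mul, Complex.norm_I,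
      Circle.norm_coe, one_mul, one_mul, norm_smul]
    exact mul_le_mul hD' (hA' x) (norm_nonneg _) ((norm_nonneg _).trans hD')

instance isFiniteMeasure_restrict_ball (R : ℝ) :
    IsFiniteMeasure ((volume : Measure ℂ).restrict (Metric.ball 0 R)) :=
  ⟨by simpa using measure_ball_lt_top (μ := (volume : Measure ℂ)) (x := 0) (r := R)⟩

theorem memLp_of_bound_on_annulus {G : Type*} [NormedAddCommGroup G] {f : ℂ → G} {a b : ℝ}
    (hf : StronglyMeasurable f)
    (hb : ∃ C, ∀ x ∈ Metric.ball (0 : ℂ) b \ Metric.ball 0 a, ‖f x‖ ≤ C) :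
    MemLp f 2 (volume.restrict (Metric.ball (0 : ℂ) b \ Metric.ball 0 a)) := by
  obtain ⟨C, hC⟩ := hb
  have : IsFiniteMeasure ((volume : Measure ℂ).restrict (Metric.ball 0 b \ Metric.ball 0 a)) :=
    isFiniteMeasure_of_le _ (Measure.restrict_mono_set volume sdiff_subset)
  exact MemLp.of_bound hf.aestronglyMeasurable C
    (ae_restrict_of_forall_mem (measurableSet_ball.diff measurableSet_ball) hC)

/-! ### Traces and weak derivatives -/

theorem integrableOn_fderiv_smul {φ : ℂ → ℝ} (hφ : ContDiff ℝ ∞ φ) (hφc : HasCompactSupport φ)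
    {R : ℝ} {u : ℂ → E} (hu : MemLp u 2 (volume.restrict (Metric.ball 0 R))) (v : ℂ) :
    IntegrableOn (fun x => fderiv ℝ φ x v • u x) (Metric.ball 0 R) := by
  have hc : Continuous (fun x => fderiv ℝ φ x v) :=
    (hφ.continuous_fderiv (by simp)).clm_apply continuous_const
  obtain ⟨C, hC⟩ := (hφc.fderiv_apply ℝ v).exists_bound_of_continuous hc
  exact (hu.integrable (by norm_num)).bdd_smul C hc.aestronglyMeasurable (.of_forall hC)

theorem integrableOn_smul_apply {φ : ℂ → ℝ} (hφ : Continuous φ) (hφc : HasCompactSupport φ)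
    {R : ℝ} {Du : ℂ → ℂ →L[ℝ] E} (hDu : MemLp Du 2 (volume.restrict (Metric.ball 0 R))) (v : ℂ) :
    IntegrableOn (fun x => φ x • Du x v) (Metric.ball 0 R) := by
  obtain ⟨C, hC⟩ := hφc.exists_bound_of_continuous hφ
  exact ((ContinuousLinearMap.apply ℝ E v).integrable_comp
    (hDu.integrable (by norm_num))).bdd_smul C hφ.aestronglyMeasurable (.of_forall hC)

/-- Green's formula with boundary values contains the definition of the weak derivative: a test
function supported in the open disk does not see the boundary. -/
theorem HasTrace.isSobolevMap {R : ℝ} (hR : 0 ≤ R) {u : ℂ → Space ν} {Du : ℂ → ℂ →L[ℝ] Space ν}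
    {γ : Circle → Space ν} (h : HasTrace R u Du γ)
    (hu : MemLp u 2 (volume.restrict (Metric.ball 0 R)))
    (hDu : MemLp Du 2 (volume.restrict (Metric.ball 0 R))) :
    IsSobolevMap (Metric.ball 0 R) u Du := by
  refine ⟨hu, hDu, fun φ hφ hφc hφs v => ?_⟩
  have hz : ∀ ζ : Circle, φ (R * (ζ : ℂ)) = 0 := fun ζ => by
    refine image_eq_zero_of_notMem_tsupport fun hζ => ?_
    have := hφs hζ
    rw [mem_ball_zero_iff, norm_mul, Circle.norm_coe, Complex.norm_real, Real.norm_of_nonneg hR,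
      mul_one] at this
    exact lt_irrefl _ this
  have hg := h.2 φ hφ hφc v
  rw [integral_add (integrableOn_fderiv_smul hφ hφc hu v)
    (integrableOn_smul_apply hφ.continuous hφc hDu v)] at hg
  simp only [hz, zero_mul, zero_smul, integral_zero, smul_zero] at hg
  exact eq_neg_of_add_eq_zero_left hg

instance isFiniteMeasure_arcLength : IsFiniteMeasure arcLength := by
  unfold arcLength
  infer_instance

theorem memLp_arcLength {G : Type*} [NormedAddCommGroup G] {γ : Circle → G}
    (hγ : Continuous (fun θ : ℝ => γ (Circle.exp θ))) :
    MemLp γ 2 arcLength := by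
  obtain ⟨C, hC⟩ := exists_bound_comp_arg hγ
  refine MemLp.of_bound (stronglyMeasurable_of_continuous_comp_exp hγ).aestronglyMeasurable C
    (.of_forall fun ζ => ?_)
  simpa only [Circle.exp_arg] using hC ζ

/-! ### Gluing along a circle -/

open Classical in
/-- The map equal to `f` on the open disk of radius `R` centred at `0`, and to `g` elsewhere. -/
def glue {α : Type*} (R : ℝ) (f g : ℂ → α) : ℂ → α :=
  (Metric.ball (0 : ℂ) R).piecewise f g

theorem glue_of_mem {α : Type*} {R : ℝ} {f g : ℂ → α} {x : ℂ} (hx : x ∈ Metric.ball (0 : ℂ) R) :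
    glue R f g x = f x := by
  classical exact piecewise_eq_of_mem _ _ _ hx

theorem glue_of_notMem {α : Type*} {R : ℝ} {f g : ℂ → α} {x : ℂ}
    (hx : x ∉ Metric.ball (0 : ℂ) R) : glue R f g x = g x := by
  classical exact piecewise_eq_of_notMem _ _ _ hx

theorem memLp_glue {G : Type*} [NormedAddCommGroup G] {R S : ℝ} (hRS : R ≤ S) {f g : ℂ → G}
    (hf : MemLp f 2 (volume.restrict (Metric.ball 0 R)))
    (hg : MemLp g 2 (volume.restrict (Metric.ball 0 S \ Metric.ball 0 R))) :
    MemLp (glue R f g) 2 (volume.restrict (Metric.ball 0 S)) := by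
  classical
  refine MemLp.piecewise measurableSet_ball ?_ ?_
  · rwa [Measure.restrict_restrict measurableSet_ball,
      inter_eq_left.2 (Metric.ball_subset_ball hRS)]
  · rwa [Measure.restrict_restrict measurableSet_ball.compl, inter_comm, ← sdiff_eq]

/-- If two maps have matching boundary values on the circle of radius `R`, in the sense of Green's
formula, then the flux through this circle cancels and the glued map has the outer boundary
values. -/
theorem HasTrace.glue {R S : ℝ} (hRS : R ≤ S) {u w : ℂ → Space ν}
    {Du Dw : ℂ → ℂ →L[ℝ] Space ν} {γ : Circle → Space ν} (h : HasTrace R u Du γ)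
    (hu : MemLp (glue R u w) 2 (volume.restrict (Metric.ball 0 S)))
    (hDu : MemLp (GinzburgLandau.glue R Du Dw) 2 (volume.restrict (Metric.ball 0 S)))
    (hw : ∀ φ : ℂ → ℝ, ContDiff ℝ ∞ φ → ∀ v : ℂ,
      ∫ x in Metric.ball (0 : ℂ) S \ Metric.ball 0 R, (fderiv ℝ φ x v • w x + φ x • Dw x v) =
        S • ∫ ζ : Circle, (φ (S * (ζ : ℂ)) * inner ℝ (ζ : ℂ) v) • γ ζ ∂arcLength -
        R • ∫ ζ : Circle, (φ (R * (ζ : ℂ)) * inner ℝ (ζ : ℂ) v) • γ ζ ∂arcLength) :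
    HasTrace S (GinzburgLandau.glue R u w) (GinzburgLandau.glue R Du Dw) γ := by
  refine ⟨h.1, fun φ hφ hφc v => ?_⟩
  have hint := (integrableOn_fderiv_smul hφ hφc hu v).add
    (integrableOn_smul_apply hφ.continuous hφc hDu v)
  have hball : ∫ x in Metric.ball (0 : ℂ) R, (fderiv ℝ φ x v • GinzburgLandau.glue R u w x +
      φ x • GinzburgLandau.glue R Du Dw x v) =
      ∫ x in Metric.ball (0 : ℂ) R, (fderiv ℝ φ x v • u x + φ x • Du x v) :=
    setIntegral_congr_fun measurableSet_ball fun x hx => by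
      simp only [glue_of_mem hx]
  have hann : ∫ x in Metric.ball (0 : ℂ) S \ Metric.ball 0 R,
      (fderiv ℝ φ x v • GinzburgLandau.glue R u w x + φ x • GinzburgLandau.glue R Du Dw x v) =
      ∫ x in Metric.ball (0 : ℂ) S \ Metric.ball 0 R,
        (fderiv ℝ φ x v • w x + φ x • Dw x v) :=
    setIntegral_congr_fun (measurableSet_ball.diff measurableSet_ball) fun x hx => by
      simp only [glue_of_notMem hx.2]
  have hdiff := setIntegral_sdiff measurableSet_ball hint
    (Metric.ball_subset_ball hRS : Metric.ball (0 : ℂ) R ⊆ Metric.ball 0 S)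
  simp only [Pi.add_apply] at hdiff
  rw [hball, hann, hw φ hφ v, h.2 φ hφ hφc v, sub_left_inj] at hdiff
  exact hdiff.symm

theorem energy_glue {R S : ℝ} (hRS : R ≤ S) (F : Space ν → ℝ) (u w : ℂ → Space ν)
    (Du Dw : ℂ → ℂ →L[ℝ] Space ν) :
    energy F S (glue R u w) (glue R Du Dw) = energy F R u Du +
      ∫⁻ x in Metric.ball (0 : ℂ) S \ Metric.ball 0 R,
        ENNReal.ofReal ((‖Dw x 1‖ ^ 2 + ‖Dw x Complex.I‖ ^ 2) / 2 + F (w x)) := by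
  unfold energy
  rw [← lintegral_inter_add_sdiff _ (Metric.ball 0 S) (measurableSet_ball (x := (0 : ℂ)) (ε := R)),
    inter_eq_right.2 (Metric.ball_subset_ball hRS)]
  congr 1
  · exact setLIntegral_congr_fun measurableSet_ball fun x hx => by simp only [glue_of_mem hx]
  · exact setLIntegral_congr_fun (measurableSet_ball.diff measurableSet_ball) fun x hx => by
      simp only [glue_of_notMem hx.2]

/-! ### Energy estimates -/

theorem normSq_radialDeriv_one (γ : Circle → Space ν) (x : ℂ) :
    ‖radialDeriv (fun _ => 1) γ x 1‖ ^ 2 + ‖radialDeriv (fun _ => 1) γ x Complex.I‖ ^ 2 =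
      (speed γ x.arg / ‖x‖) ^ 2 := by
  have h : (Circle.exp x.arg : ℂ).re ^ 2 + (Circle.exp x.arg : ℂ).im ^ 2 = 1 := by
    rw [pow_two, pow_two, ← Complex.normSq_apply, Circle.normSq_coe]
  rw [radialDeriv_apply, radialDeriv_apply, speed]
  simp only [deriv_const, mul_zero, zero_smul, zero_add, norm_smul, mul_pow, norm_mul,
    Real.norm_eq_abs, sq_abs, Complex.inner]
  generalize (Circle.exp x.arg : ℂ) = z at h
  simp
  linear_combination (‖x‖ ^ 2)⁻¹ * ‖deriv (fun t : ℝ => γ (Circle.exp t)) x.arg‖ ^ 2 * h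

/-- The energy of `x ↦ γ(x / |x|)` is logarithmic: `∫ c² / (2|x|²)` over an annulus. -/
theorem setLIntegral_annulus_const_div_sq {R S : ℝ} (hR : 0 < R) (hRS : R ≤ S) (c : ℝ) :
    ∫⁻ x in Metric.ball (0 : ℂ) S \ Metric.ball 0 R, ENNReal.ofReal ((c / ‖x‖) ^ 2 / 2) =
      ENNReal.ofReal (Real.pi * c ^ 2 * Real.log (S / R)) := by
  have hpos : ∀ p ∈ Icc R S ×ˢ Icc (-Real.pi) Real.pi, 0 < p.1 := fun p hp => hR.trans_le hp.1.1
  have hint : IntegrableOn (fun p : ℝ × ℝ => c ^ 2 / 2 * p.1⁻¹ * (1 : ℝ))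
      (Icc R S ×ˢ Icc (-Real.pi) Real.pi) := by
    refine ContinuousOn.integrableOn_compact (isCompact_Icc.prod isCompact_Icc) ?_
    exact (continuousOn_const.mul (continuousOn_fst.inv₀ fun p hp => (hpos p hp).ne')).mul
      continuousOn_const
  have heq : ∀ p ∈ Icc R S ×ˢ Icc (-Real.pi) Real.pi, ENNReal.ofReal p.1 *
      ENNReal.ofReal ((c / ‖(p.1 * (Circle.exp p.2 : ℂ))‖) ^ 2 / 2) =
      ENNReal.ofReal (c ^ 2 / 2 * p.1⁻¹ * 1) := fun p hp => by
    have := hpos p hp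
    rw [norm_ofReal_mul_circleExp this.le, ← ENNReal.ofReal_mul this.le]
    congr 1
    field_simp
  rw [setLIntegral_annulus hR.le,
    setLIntegral_congr_fun (measurableSet_Icc.prod measurableSet_Icc) heq,
    ← ofReal_integral_eq_lintegral_ofReal hint (ae_restrict_of_forall_mem
      (measurableSet_Icc.prod measurableSet_Icc) fun p hp => by
        have := hpos p hp
        dsimp only [Pi.zero_apply]
        positivity)]
  congr 1
  rw [Measure.volume_eq_prod, setIntegral_prod_mul (fun r : ℝ => c ^ 2 / 2 * r⁻¹) (fun _ => 1),
    integral_const_mul, integral_Icc_eq_integral_Ioc, ← intervalIntegral.integral_of_le hRS,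
    integral_inv_of_pos hR (hR.trans_le hRS)]
  simp [measureReal_def, Real.pi_pos.le]
  ring

/-- The energy of the `0`-homogeneous extension of a closed curve of constant speed `c` in the
zero set of the potential, on an annulus. -/
theorem lintegral_energyDensity_radialMap_one {F : Space ν → ℝ} {γ : Circle → Space ν} {c R S : ℝ}
    (hR : 0 < R) (hRS : R ≤ S) (hc : ∀ θ, speed γ θ = c) (hF : ∀ ζ, F (γ ζ) = 0) :
    ∫⁻ x in Metric.ball (0 : ℂ) S \ Metric.ball 0 R,
      ENNReal.ofReal ((‖radialDeriv (fun _ => 1) γ x 1‖ ^ 2 +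
        ‖radialDeriv (fun _ => 1) γ x Complex.I‖ ^ 2) / 2 + F (radialMap (fun _ => 1) γ x)) =
      ENNReal.ofReal (Real.pi * c ^ 2 * Real.log (S / R)) := by
  rw [← setLIntegral_annulus_const_div_sq hR hRS]
  simp only [normSq_radialDeriv_one, hc, radialMap, one_smul, hF, add_zero]

/-- Enlarging the disk from radius `R` to radius `S` costs at most the energy of the
`0`-homogeneous extension on the annulus in between. -/
theorem minimalEnergy_le_add {F : Space ν → ℝ} {γ : Circle → Space ν} {c R S : ℝ}
    (hR : 0 < R) (hRS : R ≤ S) (hγ : ContDiff ℝ 1 (fun θ : ℝ => γ (Circle.exp θ)))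
    (hc : ∀ θ, speed γ θ = c) (hF : ∀ ζ, F (γ ζ) = 0) :
    minimalEnergy F γ S ≤
      minimalEnergy F γ R + ENNReal.ofReal (Real.pi * c ^ 2 * Real.log (S / R)) := by
  rw [minimalEnergy, minimalEnergy, ENNReal.sInf_add]
  refine le_iInf₂ fun e he => ?_
  obtain ⟨u, Du, hu, htr, rfl⟩ := he
  rw [← lintegral_energyDensity_radialMap_one hR hRS hc hF, ← energy_glue hRS]
  have h1 : ContDiff ℝ 1 (fun _ : ℝ => (1 : ℝ)) := contDiff_const
  have hbound : ∃ D, ∀ r ∈ Icc R S, ‖1 / r‖ ≤ D := by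
    refine ⟨1 / R, fun r hr => ?_⟩
    rw [Real.norm_of_nonneg (one_div_nonneg.2 (hR.le.trans hr.1))]
    exact one_div_le_one_div_of_le hR hr.1
  have hMu := memLp_glue hRS hu.1 (memLp_of_bound_on_annulus
    (stronglyMeasurable_radialMap h1.continuous hγ.continuous)
    (exists_bound_radialMap h1.continuous hγ.continuous R S))
  have hMDu := memLp_glue hRS hu.2.1 (memLp_of_bound_on_annulus
    (stronglyMeasurable_radialDeriv h1 hγ) (exists_bound_radialDeriv h1 hγ hbound))
  have hT := htr.glue hRS hMu hMDu fun φ hφ v => by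
    simpa only [mul_one] using
      green_annulus hR.le hRS h1 hγ (hφ.of_le (by norm_cast)) v
  exact sInf_le ⟨_, _, hT.isSobolevMap (hR.le.trans hRS) hMu hMDu, hT, rfl⟩

/-- The `1`-homogeneous extension `r e^{iθ} ↦ (r / R) γ(e^{iθ})` is an admissible competitor with
bounded energy density. -/
theorem minimalEnergy_ne_top {F : Space ν → ℝ} (hF : Continuous F) {γ : Circle → Space ν}
    (hγ : ContDiff ℝ 1 (fun θ : ℝ => γ (Circle.exp θ))) {R : ℝ} (hR : 0 < R) :
    minimalEnergy F γ R ≠ ⊤ := by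
  have hh : ContDiff ℝ 1 (fun r : ℝ => r / R) := contDiff_id.div_const R
  have hbound : ∃ D, ∀ r ∈ Icc 0 R, ‖r / R / r‖ ≤ D := by
    refine ⟨1 / R, fun r hr => ?_⟩
    rw [div_right_comm, Real.norm_of_nonneg (div_nonneg (div_nonneg hr.1 hr.1) hR.le)]
    gcongr
    exact div_self_le_one r
  have hball : Metric.ball (0 : ℂ) R \ Metric.ball 0 0 = Metric.ball 0 R := by simp
  have hMb := exists_bound_radialMap hh.continuous hγ.continuous 0 R
  have hDb := exists_bound_radialDeriv hh hγ hbound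
  have hM := memLp_of_bound_on_annulus (stronglyMeasurable_radialMap hh.continuous hγ.continuous) hMb
  have hD := memLp_of_bound_on_annulus (stronglyMeasurable_radialDeriv hh hγ) hDb
  rw [hball] at hMb hDb hM hD
  have hT : HasTrace R (radialMap (fun r => r / R) γ) (radialDeriv (fun r => r / R) γ) γ := by
    refine ⟨memLp_arcLength hγ.continuous, fun φ hφ _ v => ?_⟩
    have := green_annulus le_rfl hR.le hh hγ (hφ.of_le (by norm_cast)) v
    rw [hball, zero_mul, zero_smul, sub_zero, div_self hR.ne', mul_one] at this
    exact this
  refine ne_top_of_le_ne_top ?_ (sInf_le ⟨_, _, hT.isSobolevMap hR.le hM hD, hT, rfl⟩)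
  obtain ⟨A, hA⟩ := hMb
  obtain ⟨B, hB⟩ := hDb
  obtain ⟨K, hK⟩ := (isCompact_closedBall (0 : Space ν) A).exists_bound_of_continuousOn
    hF.continuousOn
  have hle : ∀ x ∈ Metric.ball (0 : ℂ) R, ∀ v : ℂ, ‖v‖ = 1 →
      ‖radialDeriv (fun r => r / R) γ x v‖ ≤ B := fun x hx v hv => by
    simpa [hv] using (radialDeriv (fun r => r / R) γ x).le_of_opNorm_le (hB x hx) v
  -- The map is bounded, so its values stay in a compact set, on which `F` is bounded.
  refine ne_top_of_le_ne_top ?_ (setLIntegral_mono' measurableSet_ball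
    (g := fun _ => ENNReal.ofReal ((B ^ 2 + B ^ 2) / 2 + K)) fun x hx => ?_)
  · rw [setLIntegral_const]
    exact ENNReal.mul_ne_top ENNReal.ofReal_ne_top measure_ball_lt_top.ne
  · refine ENNReal.ofReal_le_ofReal (add_le_add ?_ ?_)
    · gcongr
      exacts [hle x hx 1 norm_one, hle x hx Complex.I Complex.norm_I]
    · exact (le_abs_self _).trans (hK _ (mem_closedBall_zero_iff.2 (hA x hx)))

theorem curveLength_eq_of_speed_eq {γ : Circle → Space ν} {c : ℝ} (hc : ∀ θ, speed γ θ = c) :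
    curveLength γ = 2 * Real.pi * c := by
  simp only [curveLength, hc, intervalIntegral.integral_const, smul_eq_mul]
  ring

end GinzburgLandau
end

theorem proposition4p1 {ν : ℕ} (N : Set (GinzburgLandau.Space ν))
    (hN : GinzburgLandau.IsSmoothSubmanifold N) (hNcompact : IsCompact N)
    (hNconnected : IsConnected N)
    (F : GinzburgLandau.Space ν → ℝ) (hF : Continuous F) (hF0 : ∀ z, 0 ≤ F z)
    (hFN : F ⁻¹' {0} = N)
    (γ : Circle → GinzburgLandau.Space ν)
    (hγ : GinzburgLandau.IsMinimisingClosedGeodesic N γ) :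
    (∀ R : ℝ, 0 < R → GinzburgLandau.minimalEnergy F γ R ≠ ⊤) ∧
      AntitoneOn
        (fun R : ℝ => (GinzburgLandau.minimalEnergy F γ R).toReal -
          GinzburgLandau.minimalLength N γ ^ 2 / (4 * Real.pi) * Real.log R)
        (Set.Ioi 0) := by
  obtain ⟨⟨hγC, hγN⟩, ⟨c, hc⟩, hlen⟩ := hγ
  have hfin : ∀ R : ℝ, 0 < R → GinzburgLandau.minimalEnergy F γ R ≠ ⊤ :=
    fun R hR => GinzburgLandau.minimalEnergy_ne_top hF hγC hR
  refine ⟨hfin, fun R hR S hS hRS => ?_⟩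
  have hFγ : ∀ ζ, F (γ ζ) = 0 := fun ζ => by
    have := hγN ζ
    rwa [← hFN] at this
  have hcoef : GinzburgLandau.minimalLength N γ ^ 2 / (4 * Real.pi) = Real.pi * c ^ 2 := by
    rw [← hlen, GinzburgLandau.curveLength_eq_of_speed_eq hc]
    field_simp
    ring
  have hlog : 0 ≤ Real.pi * c ^ 2 * Real.log (S / R) :=
    mul_nonneg (by positivity) (Real.log_nonneg ((one_le_div hR).2 hRS))
  have hle := ENNReal.toReal_mono (ENNReal.add_ne_top.2 ⟨hfin R hR, ENNReal.ofReal_ne_top⟩)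
    (GinzburgLandau.minimalEnergy_le_add hR hRS hγC hc hFγ)
  rw [ENNReal.toReal_add (hfin R hR) ENNReal.ofReal_ne_top, ENNReal.toReal_ofReal hlog,
    Real.log_div (ne_of_gt hS) (ne_of_gt hR)] at hle
  dsimp only
  rw [hcoef]
  linarith
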